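/- A bounded curvature path from $(x,X)$ to $(y,Y)$, with $x,y\in\mathbb R^2$ and $X,Y$ tangent vectors at $x$ and $y$, is a $C^1$ and piecewise $C^2$ path $\gamma:[0,s]\to\mathbb R^2$ ($s>0$), parametrised by arc length, with $\gamma(0)=x$, $\gamma'(0)=X$, $\gamma(s)=y$, $\gamma'(s)=Y$ and $\|\gamma''\|\le 1$ wherever $\gamma''$ is defined. Let $\Gamma$ be the space of these paths, and for $n\in\mathbb Z$ let $\Gamma(n)\subset\Gamma$ consist of the paths of turning number $n$, that is, those for which the total variation $\tau(s)-\tau(0)$ of a continuous angle $\tau$ of $\gamma'$ equals $2\pi n$ plus the angle in $(-\pi,\pi]$ from $X$ to $Y$. Two paths in $\Gamma$ are bounded-homotopic if they are joined by a one-parameter family in $\Gamma$, continuous in the $C^1$ sense. A component of type $\mathscr C_3$ is a path $\gamma\in\Gamma$ that is a concatenation of an arc of a unit circle, a line segment, an arc of a unit circle, a line segment and an arc of a unit circle (type $cscsc$, each arc with either orientation) and that has a self intersection. It is degenerate if one of the five pieces has length zero, or if its middle arc is a full circle traversed a whole number of times (so that it is a $csc$ path with full circles attached to its line segment). Proposition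 5.1. A non-degenerate component $\gamma$ of type $\mathscr C_3$ is not a path of minimal length: it is not of minimal length in the class $\Gamma(n)$ that contains it, nor in its bounded-homotopy class. Moreover, a component of type $\mathscr C_3$ all of whose five pieces have positive length (its middle arc being allowed to be a full circle traversed a whole number of times) is not of minimal length in $\Gamma$. -/

import Mathlib

open Set

/-- The Euclidean plane is `ℂ`. An element `x = (x.1, x.2)` of its tangent bundle is a pair (base
point, tangent vector). `BCPath x y` is the space `Γ(x, y)` of bounded curvature paths from `x` to
`y`, with curvature bound `1`: arc-length parametrised paths `γ : [0, s] → ℂ` that are `C¹` and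
piecewise `C²`, with `‖γ''‖ ≤ 1` on each piece and with the prescribed end points and end
directions. The values of `toFun` outside `[0, length]` carry no meaning. -/
structure BCPath (x y : ℂ × ℂ) where
  /-- the arc length `s` -/
  length : ℝ
  /-- the path -/
  toFun : ℝ → ℂ
  length_pos : 0 < length
  contDiffOn : ContDiffOn ℝ 1 toFun (Icc 0 length)
  unit_speed : ∀ t ∈ Icc 0 length, ‖derivWithin toFun (Icc 0 length) t‖ = 1
  start_point : toFun 0 = x.1
  start_dir : derivWithin toFun (Icc 0 length) 0 = x.2
  end_point : toFun length = y.1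
  end_dir : derivWithin toFun (Icc 0 length) length = y.2
  /-- There are finitely many break points; on a closed interval without break point in its interior
  the path is `C²` up to the boundary, with second derivative bounded by `1`. -/
  piecewise_curvature : ∃ B : Finset ℝ, ∀ a b : ℝ, 0 ≤ a → a < b → b ≤ length →
    (∀ p ∈ B, p ∉ Ioo a b) →
      ContDiffOn ℝ 2 toFun (Icc a b) ∧
        ∀ t ∈ Icc a b, ‖iteratedDerivWithin 2 toFun (Icc a b) t‖ ≤ 1

namespace BCPath

variable {x y : ℂ × ℂ}

/-- The velocity `γ'(t)` (one-sided at the two end points). -/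
noncomputable def velocity (γ : BCPath x y) (t : ℝ) : ℂ :=
  derivWithin γ.toFun (Icc 0 γ.length) t

/-- `τ` is a turning map of `γ`: a continuous determination on `[0, s]` of the angle between the
first axis and the velocity. -/
def IsTurningMap (γ : BCPath x y) (τ : ℝ → ℝ) : Prop :=
  ContinuousOn τ (Icc 0 γ.length) ∧
    ∀ t ∈ Icc 0 γ.length, γ.velocity t = Complex.exp (τ t * Complex.I)

/-- `γ` has turning number `n`: the total turning `τ(s) - τ(0)` is `2πn` plus the angle in `(-π, π]`
from the initial to the final direction. -/
def HasTurningNumber (γ : BCPath x y) (n : ℤ) : Prop :=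
  ∃ τ : ℝ → ℝ, γ.IsTurningMap τ ∧
    τ γ.length - τ 0 = Complex.arg (y.2 / x.2) + 2 * Real.pi * n

/-- The space `Γ(n)` of the paths in `Γ(x, y)` with turning number `n`. -/
def turningClass (x y : ℂ × ℂ) (n : ℤ) : Set (BCPath x y) :=
  {γ | γ.HasTurningNumber n}

/-- Bounded curvature homotopy: a family `H p`, `p ∈ [0, 1]`, in `Γ(x, y)` from `γ` to `η`, each
member parametrised by its own arc length, continuous in the `C¹` sense (lengths, positions and
velocities depend continuously on `p` and on the proportion `t ∈ [0, 1]` of arc length). -/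
def BoundedHomotopic (γ η : BCPath x y) : Prop :=
  ∃ H : unitInterval → BCPath x y,
    ((H 0).length = γ.length ∧ EqOn (H 0).toFun γ.toFun (Icc 0 γ.length)) ∧
    ((H 1).length = η.length ∧ EqOn (H 1).toFun η.toFun (Icc 0 η.length)) ∧
    Continuous (fun p => (H p).length) ∧
    Continuous (fun q : unitInterval × unitInterval =>
      (H q.1).toFun ((q.2 : ℝ) * (H q.1).length)) ∧
    Continuous (fun q : unitInterval × unitInterval =>
      (H q.1).velocity ((q.2 : ℝ) * (H q.1).length))

/-- The bounded-homotopy class of `γ` in `Γ(x, y)`. -/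
def homotopyClass (γ : BCPath x y) : Set (BCPath x y) :=
  {η | γ.BoundedHomotopic η}

/-- `γ` restricted to `[u, v]` is a line segment (component of type `s`). -/
def IsSegmentOn (γ : BCPath x y) (u v : ℝ) : Prop :=
  ∃ w : ℂ, ∀ t ∈ Icc u v, γ.toFun t = γ.toFun u + ((t - u : ℝ) : ℂ) * w

/-- `γ` restricted to `[u, v]` is an arc of a unit circle with centre `c` (component of type `c`),
traversed counterclockwise (`ε = 1`, type `l`) or clockwise (`ε = -1`, type `r`). -/
def IsArcOn (γ : BCPath x y) (u v : ℝ) : Prop :=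
  ∃ (c : ℂ) (φ ε : ℝ), (ε = 1 ∨ ε = -1) ∧
    ∀ t ∈ Icc u v, γ.toFun t = c + Complex.exp ((φ + ε * (t - u) : ℝ) * Complex.I)

/-- `γ` is a `cscsc` path with consecutive pieces on `[0, t₁]`, `[t₁, t₂]`, `[t₂, t₃]`, `[t₃, t₄]`,
`[t₄, s]`, some of which may have length zero. -/
def IsCSCSC (γ : BCPath x y) (t₁ t₂ t₃ t₄ : ℝ) : Prop :=
  (0 ≤ t₁ ∧ t₁ ≤ t₂ ∧ t₂ ≤ t₃ ∧ t₃ ≤ t₄ ∧ t₄ ≤ γ.length) ∧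
    γ.IsArcOn 0 t₁ ∧ γ.IsSegmentOn t₁ t₂ ∧ γ.IsArcOn t₂ t₃ ∧
    γ.IsSegmentOn t₃ t₄ ∧ γ.IsArcOn t₄ γ.length

/-- `γ` has a loop, i.e. a self intersection. -/
def HasLoop (γ : BCPath x y) : Prop :=
  ∃ a ∈ Icc 0 γ.length, ∃ b ∈ Icc 0 γ.length, a < b ∧ γ.toFun a = γ.toFun b

/-- A component of type `𝒞₃`: a `cscsc` path with a loop. -/
def IsTypeC3 (γ : BCPath x y) (t₁ t₂ t₃ t₄ : ℝ) : Prop :=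
  γ.IsCSCSC t₁ t₂ t₃ t₄ ∧ γ.HasLoop

/-- One of the five pieces has length zero. -/
def HasTrivialPiece (γ : BCPath x y) (t₁ t₂ t₃ t₄ : ℝ) : Prop :=
  t₁ = 0 ∨ t₂ = t₁ ∨ t₃ = t₂ ∨ t₄ = t₃ ∨ γ.length = t₄

/-- A component of type `𝒞₃` is degenerate if one of its pieces has length zero, or if its middle
arc is a full circle traversed a whole number of times, so that the component is a `csc` path with
full circles attached to its line segment. -/
def IsDegenerate (γ : BCPath x y) (t₁ t₂ t₃ t₄ : ℝ) : Prop :=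
  γ.HasTrivialPiece t₁ t₂ t₃ t₄ ∨ ∃ k : ℕ, t₃ - t₂ = 2 * Real.pi * k

end BCPath

open Complex Filter Topology

/-! A `cscsc` path is fixed by the angle of its velocity, which is constant on the two segments, say
`φ₁` and `φ₂`. Hold the first and last circles fixed and translate the middle circle by `s v`,
keeping each pair of consecutive circles joined by a common tangent segment. The vector between
consecutive centres is `(b + iα)e^{iφ}`, with `b` the segment length, `φ` its angle and `α` the
difference of orientations. The total length is a sum of terms `b - αφ` and a constant, and `b - αφ`
has gradient `e^{iφ}` in that vector (`exists_tangent_family`). For `v = e^{iφ₂} - e^{iφ₁}` the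
length thus has derivative `-|v|²`. This is negative unless the segments are parallel with the same
direction, that is, unless the middle arc is a whole number of full circles.

End angles are fixed along the deformation, so it stays in one turning class and is a bounded
homotopy (`exists_shorter_of_cscscAngle`). In the remaining case `v = 0`, and the full circles are
cut out, which shortens the path in `Γ` (`exists_shorter_of_full_circles`). -/

namespace BCPath

/-! ### Paths built from the angle of their velocity -/

/-- The path starting at `z` whose velocity has angle `θ`. -/
noncomputable def angleCurve (z : ℂ) (θ : ℝ → ℝ) (t : ℝ) : ℂ :=
  z + ∫ u in (0 : ℝ)..t, exp (θ u * I)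

theorem continuous_exp_angle {θ : ℝ → ℝ} (hθ : Continuous θ) :
    Continuous fun u => exp (θ u * I) := by fun_prop

theorem hasDerivAt_angleCurve (z : ℂ) {θ : ℝ → ℝ} (hθ : Continuous θ) (t : ℝ) :
    HasDerivAt (angleCurve z θ) (exp (θ t * I)) t :=
  ((continuous_exp_angle hθ).integral_hasStrictDerivAt 0 t).hasDerivAt.const_add z

theorem derivWithin_angleCurve (z : ℂ) {θ : ℝ → ℝ} (hθ : Continuous θ) {a b t : ℝ} (hab : a < b)
    (ht : t ∈ Icc a b) : derivWithin (angleCurve z θ) (Icc a b) t = exp (θ t * I) :=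
  (hasDerivAt_angleCurve z hθ t).hasDerivWithinAt.derivWithin (uniqueDiffOn_Icc hab t ht)

theorem contDiff_angleCurve (z : ℂ) {θ : ℝ → ℝ} (hθ : Continuous θ) :
    ContDiff ℝ 1 (angleCurve z θ) := by
  rw [contDiff_one_iff_deriv]
  refine ⟨fun t => (hasDerivAt_angleCurve z hθ t).differentiableAt, ?_⟩
  rw [show deriv (angleCurve z θ) = fun t => exp (θ t * I) from
    funext fun t => (hasDerivAt_angleCurve z hθ t).deriv]
  exact continuous_exp_angle hθ

theorem hasDerivAt_exp_affine (m κ t : ℝ) :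
    HasDerivAt (fun t : ℝ => exp ((m + κ * t : ℝ) * I)) (κ * I * exp ((m + κ * t : ℝ) * I)) t := by
  have h : HasDerivAt (fun t : ℝ => m + κ * t) κ t := by
    simpa using ((hasDerivAt_id t).const_mul κ).const_add m
  have := (h.ofReal_comp.mul_const I).cexp
  convert this using 1
  ring

theorem angleCurve_curvature (z : ℂ) {θ : ℝ → ℝ} (hθ : Continuous θ) {a b m κ : ℝ} (hab : a < b)
    (hκ : |κ| ≤ 1) (h : ∀ t ∈ Icc a b, θ t = m + κ * t) :
    ContDiffOn ℝ 2 (angleCurve z θ) (Icc a b) ∧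
      ∀ t ∈ Icc a b, ‖iteratedDerivWithin 2 (angleCurve z θ) (Icc a b) t‖ ≤ 1 := by
  have hd : EqOn (derivWithin (angleCurve z θ) (Icc a b))
      (fun t : ℝ => exp ((m + κ * t : ℝ) * I)) (Icc a b) := fun t ht => by
    simp only [derivWithin_angleCurve z hθ hab ht, h t ht]
  have hs : ContDiff ℝ 1 (fun t : ℝ => exp ((m + κ * t : ℝ) * I)) := by
    have : ContDiff ℝ 1 (fun t : ℝ => ((m + κ * t : ℝ) : ℂ)) :=
      ofRealCLM.contDiff.comp (contDiff_const.add (contDiff_const.mul contDiff_id))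
    exact (this.mul contDiff_const).cexp
  constructor
  · rw [show (2 : WithTop ℕ∞) = 1 + 1 from by norm_num,
      contDiffOn_succ_iff_derivWithin (uniqueDiffOn_Icc hab)]
    refine ⟨fun t _ => (hasDerivAt_angleCurve z hθ t).differentiableAt.differentiableWithinAt,
      by simp, hs.contDiffOn.congr hd⟩
  · intro t ht
    rw [iteratedDerivWithin_succ, derivWithin_congr (f := fun t : ℝ => exp ((m + κ * t : ℝ) * I)),
      (hasDerivAt_exp_affine m κ t).hasDerivWithinAt.derivWithin (uniqueDiffOn_Icc hab t ht),
      norm_mul, norm_exp_ofReal_mul_I]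
    · simpa using hκ
    · intro t ht
      rw [iteratedDerivWithin_one]
      exact hd ht
    · rw [iteratedDerivWithin_one]
      exact hd ht

/-- Finitely many points cut the line into intervals on which `θ` is affine of slope at
most `1`. -/
def IsPiecewiseAffine (θ : ℝ → ℝ) : Prop :=
  ∃ B : Finset ℝ, ∀ a b : ℝ, a < b → (∀ p ∈ B, p ∉ Ioo a b) →
    ∃ m κ : ℝ, |κ| ≤ 1 ∧ ∀ t ∈ Icc a b, θ t = m + κ * t

/-- The bounded curvature path whose velocity has the given piecewise affine angle. -/
noncomputable def ofAngle {x y : ℂ × ℂ} (θ : ℝ → ℝ) (L : ℝ) (hL : 0 < L) (hθ : Continuous θ)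
    (hB : IsPiecewiseAffine θ) (hx : exp (θ 0 * I) = x.2) (hy : exp (θ L * I) = y.2)
    (hxy : angleCurve x.1 θ L = y.1) : BCPath x y where
  length := L
  toFun := angleCurve x.1 θ
  length_pos := hL
  contDiffOn := (contDiff_angleCurve _ hθ).contDiffOn
  unit_speed t ht := by
    rw [derivWithin_angleCurve _ hθ hL ht, norm_exp_ofReal_mul_I]
  start_point := by simp [angleCurve]
  start_dir := by rw [derivWithin_angleCurve _ hθ hL ⟨le_rfl, hL.le⟩, hx]
  end_point := hxy
  end_dir := by rw [derivWithin_angleCurve _ hθ hL ⟨hL.le, le_rfl⟩, hy]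
  piecewise_curvature := by
    obtain ⟨B, hB⟩ := hB
    refine ⟨B, fun a b _ hab _ hp => ?_⟩
    obtain ⟨m, κ, hκ, h⟩ := hB a b hab hp
    exact angleCurve_curvature _ hθ hab hκ h

/-! ### Velocity of a given path on its pieces -/

variable {x y : ℂ × ℂ}

theorem hasDerivWithinAt (γ : BCPath x y) {t : ℝ} (ht : t ∈ Icc 0 γ.length) :
    HasDerivWithinAt γ.toFun (γ.velocity t) (Icc 0 γ.length) t :=
  ((γ.contDiffOn.differentiableOn (by norm_num)) t ht).hasDerivWithinAt

/-- Derivatives within a nontrivial interval are unique even at its ends, so a formula valid on one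
piece also gives the velocity at the break points, where the pieces are then matched. -/
theorem velocity_eq_of_hasDerivWithinAt (γ : BCPath x y) {u v t : ℝ} (hu : 0 ≤ u) (huv : u < v)
    (hv : v ≤ γ.length) (ht : t ∈ Icc u v) {f : ℝ → ℂ} {f' : ℂ}
    (hf : ∀ r ∈ Icc u v, γ.toFun r = f r) (hf' : HasDerivAt f f' t) : γ.velocity t = f' := by
  have h₁ := (γ.hasDerivWithinAt (Icc_subset_Icc hu hv ht)).mono (Icc_subset_Icc hu hv)
  have h₂ : HasDerivWithinAt γ.toFun f' (Icc u v) t :=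
    hf'.hasDerivWithinAt.congr hf (hf t ht)
  exact (uniqueDiffOn_Icc huv t ht).eq_deriv _ h₁ h₂

theorem IsSegmentOn.velocity_eq {γ : BCPath x y} {u v : ℝ} (h : γ.IsSegmentOn u v) (hu : 0 ≤ u)
    (huv : u < v) (hv : v ≤ γ.length) : ∀ t ∈ Icc u v, γ.velocity t = γ.velocity u := by
  obtain ⟨w, hw⟩ := h
  have key : ∀ t ∈ Icc u v, γ.velocity t = w := fun t ht => by
    refine γ.velocity_eq_of_hasDerivWithinAt hu huv hv ht hw ?_
    have := (((hasDerivAt_id t).sub_const u).ofReal_comp.mul_const w).const_add (γ.toFun u)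
    simpa using this
  intro t ht
  rw [key t ht, key u ⟨le_rfl, huv.le⟩]

theorem IsArcOn.velocity_eq {γ : BCPath x y} {u v : ℝ} (h : γ.IsArcOn u v) (hu : 0 ≤ u)
    (huv : u < v) (hv : v ≤ γ.length) : ∃ ε : ℝ, (ε = 1 ∨ ε = -1) ∧
      ∀ t ∈ Icc u v, γ.velocity t = γ.velocity u * exp ((ε * (t - u) : ℝ) * I) := by
  obtain ⟨c, φ, ε, hε, hw⟩ := h
  refine ⟨ε, hε, ?_⟩
  have key : ∀ t ∈ Icc u v, γ.velocity t = ε * I * exp ((φ + ε * (t - u) : ℝ) * I) :=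
      fun t ht => by
    refine γ.velocity_eq_of_hasDerivWithinAt hu huv hv ht hw ?_
    have := (hasDerivAt_exp_affine (φ - ε * u) ε t).const_add c
    have e : ∀ r, φ + ε * (r - u) = φ - ε * u + ε * r := fun r => by ring
    simp only [e]
    exact this
  intro t ht
  rw [key t ht, key u ⟨le_rfl, huv.le⟩, mul_assoc (ε * I), ← exp_add]
  congr 2
  push_cast
  ring

theorem eqOn_angleCurve (γ : BCPath x y) {θ : ℝ → ℝ} (hθ : Continuous θ)
    (h : ∀ t ∈ Icc 0 γ.length, γ.velocity t = exp (θ t * I)) :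
    EqOn γ.toFun (angleCurve x.1 θ) (Icc 0 γ.length) := by
  refine eq_of_has_deriv_right_eq (f' := fun t => exp (θ t * I)) ?_ ?_ ?_ ?_ ?_
  · intro t ht
    rw [← h t (Ico_subset_Icc_self ht)]
    exact (γ.hasDerivWithinAt (Ico_subset_Icc_self ht)).mono_of_mem_nhdsWithin
      (Icc_mem_nhdsGE_of_mem ht)
  · exact fun t _ => (hasDerivAt_angleCurve _ hθ t).hasDerivWithinAt
  · exact γ.contDiffOn.continuousOn
  · exact (contDiff_angleCurve _ hθ).continuous.continuousOn
  · simp [γ.start_point, angleCurve]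

/-! ### The angle function of a `cscsc` path and its displacement -/

/-- The angle of the velocity of a `cscsc` path with break points `T₁`, `T₂`, `T₃`, `T₄`, initial
angle `θ₀` and orientations `ε₁`, `ε₂`, `ε₃`. -/
noncomputable def cscscAngle (θ₀ ε₁ ε₂ ε₃ T₁ T₂ T₃ T₄ t : ℝ) : ℝ :=
  θ₀ + ε₁ * min t T₁ + ε₂ * (max T₂ (min t T₃) - T₂) + ε₃ * (max t T₄ - T₄)

section CscscAngle

variable {θ₀ ε₁ ε₂ ε₃ T₁ T₂ T₃ T₄ t : ℝ}

/-- Writing the angle with `min` and `max` instead of cases makes joint continuity in time and break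
points immediate; the homotopy needs it. -/
theorem continuous_cscscAngle_comp {X : Type*} [TopologicalSpace X] {f₁ f₂ f₃ f₄ g : X → ℝ}
    (h₁ : Continuous f₁) (h₂ : Continuous f₂) (h₃ : Continuous f₃) (h₄ : Continuous f₄)
    (hg : Continuous g) :
    Continuous fun a => cscscAngle θ₀ ε₁ ε₂ ε₃ (f₁ a) (f₂ a) (f₃ a) (f₄ a) (g a) := by
  unfold cscscAngle
  fun_prop

theorem continuous_cscscAngle : Continuous (cscscAngle θ₀ ε₁ ε₂ ε₃ T₁ T₂ T₃ T₄) :=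
  continuous_cscscAngle_comp continuous_const continuous_const continuous_const continuous_const
    continuous_id

theorem cscscAngle_first (h₁₂ : T₁ ≤ T₂) (h₂₃ : T₂ ≤ T₃) (h₃₄ : T₃ ≤ T₄) (ht : t ≤ T₁) :
    cscscAngle θ₀ ε₁ ε₂ ε₃ T₁ T₂ T₃ T₄ t = θ₀ + ε₁ * t := by
  rw [cscscAngle, min_eq_left ht, min_eq_left (by linarith), max_eq_left (by linarith),
    max_eq_right (by linarith)]
  ring

theorem cscscAngle_second (h₂₃ : T₂ ≤ T₃) (h₃₄ : T₃ ≤ T₄) (ht : t ∈ Icc T₁ T₂) :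
    cscscAngle θ₀ ε₁ ε₂ ε₃ T₁ T₂ T₃ T₄ t = θ₀ + ε₁ * T₁ := by
  obtain ⟨h, h'⟩ := ht
  rw [cscscAngle, min_eq_right h, min_eq_left (by linarith), max_eq_left (by linarith),
    max_eq_right (by linarith)]
  ring

theorem cscscAngle_third (h₁₂ : T₁ ≤ T₂) (h₃₄ : T₃ ≤ T₄) (ht : t ∈ Icc T₂ T₃) :
    cscscAngle θ₀ ε₁ ε₂ ε₃ T₁ T₂ T₃ T₄ t = θ₀ + ε₁ * T₁ + ε₂ * (t - T₂) := by
  obtain ⟨h, h'⟩ := ht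
  rw [cscscAngle, min_eq_right (by linarith), min_eq_left (by linarith),
    max_eq_right (by linarith), max_eq_right (by linarith)]
  ring

theorem cscscAngle_fourth (h₁₂ : T₁ ≤ T₂) (h₂₃ : T₂ ≤ T₃) (ht : t ∈ Icc T₃ T₄) :
    cscscAngle θ₀ ε₁ ε₂ ε₃ T₁ T₂ T₃ T₄ t = θ₀ + ε₁ * T₁ + ε₂ * (T₃ - T₂) := by
  obtain ⟨h, h'⟩ := ht
  rw [cscscAngle, min_eq_right (by linarith), min_eq_right (by linarith),
    max_eq_right (by linarith), max_eq_right (by linarith)]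
  ring

theorem cscscAngle_fifth (h₁₂ : T₁ ≤ T₂) (h₂₃ : T₂ ≤ T₃) (h₃₄ : T₃ ≤ T₄) (ht : T₄ ≤ t) :
    cscscAngle θ₀ ε₁ ε₂ ε₃ T₁ T₂ T₃ T₄ t =
      θ₀ + ε₁ * T₁ + ε₂ * (T₃ - T₂) + ε₃ * (t - T₄) := by
  rw [cscscAngle, min_eq_right (by linarith), min_eq_right (by linarith),
    max_eq_right (by linarith), max_eq_left (by linarith)]

theorem isPiecewiseAffine_cscscAngle (h₁ : |ε₁| ≤ 1) (h₂ : |ε₂| ≤ 1) (h₃ : |ε₃| ≤ 1)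
    (h₁₂ : T₁ ≤ T₂) (h₂₃ : T₂ ≤ T₃) (h₃₄ : T₃ ≤ T₄) :
    IsPiecewiseAffine (cscscAngle θ₀ ε₁ ε₂ ε₃ T₁ T₂ T₃ T₄) := by
  refine ⟨{T₁, T₂, T₃, T₄}, fun a b hab hp => ?_⟩
  simp only [Finset.mem_insert, Finset.mem_singleton, forall_eq_or_imp, forall_eq, mem_Ioo,
    not_and, not_lt] at hp
  obtain ⟨p₁, p₂, p₃, p₄⟩ := hp
  rcases le_or_gt b T₁ with q₁ | q₁
  · exact ⟨θ₀, ε₁, h₁, fun t ht => cscscAngle_first h₁₂ h₂₃ h₃₄ (ht.2.trans q₁)⟩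
  have r₁ : T₁ ≤ a := not_lt.1 fun h => q₁.not_ge (p₁ h)
  rcases le_or_gt b T₂ with q₂ | q₂
  · refine ⟨θ₀ + ε₁ * T₁, 0, by simp, fun t ht => ?_⟩
    rw [cscscAngle_second h₂₃ h₃₄ ⟨r₁.trans ht.1, ht.2.trans q₂⟩]
    ring
  have r₂ : T₂ ≤ a := not_lt.1 fun h => q₂.not_ge (p₂ h)
  rcases le_or_gt b T₃ with q₃ | q₃
  · refine ⟨θ₀ + ε₁ * T₁ - ε₂ * T₂, ε₂, h₂, fun t ht => ?_⟩
    rw [cscscAngle_third h₁₂ h₃₄ ⟨r₂.trans ht.1, ht.2.trans q₃⟩]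
    ring
  have r₃ : T₃ ≤ a := not_lt.1 fun h => q₃.not_ge (p₃ h)
  rcases le_or_gt b T₄ with q₄ | q₄
  · refine ⟨θ₀ + ε₁ * T₁ + ε₂ * (T₃ - T₂), 0, by simp, fun t ht => ?_⟩
    rw [cscscAngle_fourth h₁₂ h₂₃ ⟨r₃.trans ht.1, ht.2.trans q₄⟩]
    ring
  have r₄ : T₄ ≤ a := not_lt.1 fun h => q₄.not_ge (p₄ h)
  refine ⟨θ₀ + ε₁ * T₁ + ε₂ * (T₃ - T₂) - ε₃ * T₄, ε₃, h₃, fun t ht => ?_⟩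
  rw [cscscAngle_fifth h₁₂ h₂₃ h₃₄ (r₄.trans ht.1)]
  ring

theorem integral_exp_affine {ε : ℝ} (hε : ε = 1 ∨ ε = -1) (m u v : ℝ) :
    ∫ t in u..v, exp ((m + ε * t : ℝ) * I) =
      -(I * ε * (exp ((m + ε * v : ℝ) * I) - exp ((m + ε * u : ℝ) * I))) := by
  have h : ∀ t ∈ uIcc u v, HasDerivAt (fun t : ℝ => -(I * ε * exp ((m + ε * t : ℝ) * I)))
      (exp ((m + ε * t : ℝ) * I)) t := fun t _ => by
    have := ((hasDerivAt_exp_affine m ε t).const_mul (I * ε)).neg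
    refine this.congr_deriv ?_
    have : (ε : ℂ) * ε = 1 := by rcases hε with rfl | rfl <;> simp
    linear_combination (-exp ((m + ε * t : ℝ) * I)) * I * I * this
      - (exp ((m + ε * t : ℝ) * I)) * I_mul_I
  rw [intervalIntegral.integral_eq_sub_of_hasDerivAt h
    (Continuous.intervalIntegrable (by fun_prop) _ _)]
  ring

theorem integral_exp_of_affine {θ : ℝ → ℝ} {ε : ℝ} (hε : ε = 1 ∨ ε = -1) {m u v : ℝ}
    (huv : u ≤ v) (h : ∀ t ∈ Icc u v, θ t = m + ε * t) :
    ∫ t in u..v, exp (θ t * I) = -(I * ε * (exp (θ v * I) - exp (θ u * I))) := by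
  rw [h u ⟨le_rfl, huv⟩, h v ⟨huv, le_rfl⟩, ← integral_exp_affine hε]
  refine intervalIntegral.integral_congr fun t ht => ?_
  rw [uIcc_of_le huv] at ht
  simp only [h t ht]

theorem integral_exp_of_const {θ : ℝ → ℝ} {m u v : ℝ} (huv : u ≤ v)
    (h : ∀ t ∈ Icc u v, θ t = m) :
    ∫ t in u..v, exp (θ t * I) = (v - u : ℝ) * exp (m * I) := by
  rw [intervalIntegral.integral_congr (g := fun _ => exp (m * I))]
  · simp
  · intro t ht
    rw [uIcc_of_le huv] at ht
    simp only [h t ht]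

/-- The terms are grouped by centres: from the start to the first centre, then the two vectors
between consecutive centres, then from the last centre to the end. Each middle term has the form
treated in `exists_tangent_family`. -/
theorem integral_exp_cscscAngle {T₅ : ℝ} (h₁ : ε₁ = 1 ∨ ε₁ = -1) (h₂ : ε₂ = 1 ∨ ε₂ = -1)
    (h₃ : ε₃ = 1 ∨ ε₃ = -1) (h₀₁ : 0 ≤ T₁) (h₁₂ : T₁ ≤ T₂) (h₂₃ : T₂ ≤ T₃) (h₃₄ : T₃ ≤ T₄)
    (h₄₅ : T₄ ≤ T₅) :
    ∫ t in (0 : ℝ)..T₅, exp (cscscAngle θ₀ ε₁ ε₂ ε₃ T₁ T₂ T₃ T₄ t * I) =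
      I * ε₁ * exp (θ₀ * I)
      + ((T₂ - T₁ : ℝ) + I * (ε₂ - ε₁ : ℝ)) * exp ((θ₀ + ε₁ * T₁ : ℝ) * I)
      + ((T₄ - T₃ : ℝ) + I * (ε₃ - ε₂ : ℝ)) * exp ((θ₀ + ε₁ * T₁ + ε₂ * (T₃ - T₂) : ℝ) * I)
      - I * ε₃ * exp ((θ₀ + ε₁ * T₁ + ε₂ * (T₃ - T₂) + ε₃ * (T₅ - T₄) : ℝ) * I) := by
  have hi : ∀ u v, IntervalIntegrable
      (fun t : ℝ => exp (cscscAngle θ₀ ε₁ ε₂ ε₃ T₁ T₂ T₃ T₄ t * I)) MeasureTheory.volume u v :=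
    fun u v => (continuous_exp_angle continuous_cscscAngle).intervalIntegrable u v
  rw [← intervalIntegral.integral_add_adjacent_intervals (hi 0 T₄) (hi T₄ T₅),
    ← intervalIntegral.integral_add_adjacent_intervals (hi 0 T₃) (hi T₃ T₄),
    ← intervalIntegral.integral_add_adjacent_intervals (hi 0 T₂) (hi T₂ T₃),
    ← intervalIntegral.integral_add_adjacent_intervals (hi 0 T₁) (hi T₁ T₂),
    integral_exp_of_affine h₁ h₀₁ fun t ht => cscscAngle_first h₁₂ h₂₃ h₃₄ ht.2,
    integral_exp_of_const h₁₂ fun t ht => cscscAngle_second h₂₃ h₃₄ ht,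
    integral_exp_of_affine (m := θ₀ + ε₁ * T₁ - ε₂ * T₂) h₂ h₂₃ fun t ht => by
      rw [cscscAngle_third h₁₂ h₃₄ ht]; ring,
    integral_exp_of_const h₃₄ fun t ht => cscscAngle_fourth h₁₂ h₂₃ ht,
    integral_exp_of_affine (m := θ₀ + ε₁ * T₁ + ε₂ * (T₃ - T₂) - ε₃ * T₄) h₃ h₄₅ fun t ht => by
      rw [cscscAngle_fifth h₁₂ h₂₃ h₃₄ ht.1]; ring,
    cscscAngle_first h₁₂ h₂₃ h₃₄ h₀₁, cscscAngle_first h₁₂ h₂₃ h₃₄ le_rfl,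
    cscscAngle_third h₁₂ h₃₄ ⟨le_rfl, h₂₃⟩, cscscAngle_fourth h₁₂ h₂₃ ⟨le_rfl, h₃₄⟩,
    cscscAngle_fourth h₁₂ h₂₃ ⟨h₃₄, le_rfl⟩, cscscAngle_fifth h₁₂ h₂₃ h₃₄ h₄₅]
  simp only [mul_zero, add_zero, sub_self]
  push_cast
  ring

end CscscAngle

/-! ### Common tangents of two circles under translation -/

/-- `(b + iα)e^{iφ} = w` can be solved for `(b, φ)` near a solution with `b > 0`, and then `b - αφ`
is a function of `w` with gradient `e^{iφ}`. -/
theorem exists_tangent_family (α b₀ φ₀ : ℝ) (hb : 0 < b₀) (v : ℂ) :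
    ∃ b φ : ℝ → ℝ, b 0 = b₀ ∧ φ 0 = φ₀ ∧
      (∀ᶠ s in 𝓝 0, ContinuousAt b s ∧ ContinuousAt φ s ∧
        ((b s : ℝ) + I * α) * exp (φ s * I) = (b₀ + I * α) * exp (φ₀ * I) + s * v) ∧
      HasDerivAt (fun s => b s - α * φ s) (v * exp (-(φ₀ * I))).re 0 := by
  set w : ℝ → ℂ := fun s => (b₀ + I * α) * exp (φ₀ * I) + s * v with hw
  -- Taking moduli forces `b² + α² = |w|²`. The quotient `u` is then the rotation still missing; it
  -- starts at `1`, so the principal logarithm gives its angle smoothly.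
  set b : ℝ → ℝ := fun s => √(normSq (w s) - α ^ 2) with hbdef
  set u : ℝ → ℂ := fun s => w s / ((b s + I * α) * exp (φ₀ * I)) with hu
  set φ : ℝ → ℝ := fun s => φ₀ + (log (u s)).im with hφ
  have hw' : ∀ s, DifferentiableAt ℝ w s := fun s => by
    have : DifferentiableAt ℝ (fun s : ℝ => (s : ℂ)) s := ofRealCLM.differentiableAt
    fun_prop
  have hn : Differentiable ℝ fun s => normSq (w s) - α ^ 2 := by
    intro s
    have h₁ : DifferentiableAt ℝ (fun s => (w s).re) s :=
      reCLM.differentiableAt.comp s (hw' s)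
    have h₂ : DifferentiableAt ℝ (fun s => (w s).im) s :=
      imCLM.differentiableAt.comp s (hw' s)
    simp only [normSq_apply]
    fun_prop
  have hn0 : normSq (w 0) - α ^ 2 = b₀ ^ 2 := by
    have : normSq (exp (φ₀ * I)) = 1 := by
      rw [normSq_eq_norm_sq, norm_exp_ofReal_mul_I]; norm_num
    simp only [hw, ofReal_zero, zero_mul, add_zero, normSq_mul, this]
    simp [normSq_apply]
    ring
  have hb0 : b 0 = b₀ := by
    simp only [hbdef, hn0, Real.sqrt_sq hb.le]
  have hpos : ∀ᶠ s in 𝓝 (0 : ℝ), 0 < normSq (w s) - α ^ 2 :=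
    hn.continuous.continuousAt.eventually_const_lt (by simp only [hn0]; positivity)
  have hbd : ∀ s, 0 < normSq (w s) - α ^ 2 → DifferentiableAt ℝ b s := fun s hs =>
    (hn s).sqrt hs.ne'
  have hden : ∀ s, 0 < normSq (w s) - α ^ 2 → ((b s : ℂ) + I * α) * exp (φ₀ * I) ≠ 0 := by
    intro s hs
    refine mul_ne_zero (fun h => ?_) (exp_ne_zero _)
    have := congrArg re h
    simp at this
    exact (Real.sqrt_pos.2 hs).ne' this
  have hud : ∀ s, 0 < normSq (w s) - α ^ 2 → DifferentiableAt ℝ u s := fun s hs => by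
    have : DifferentiableAt ℝ (fun s => (b s : ℂ)) s :=
      ofRealCLM.differentiableAt.comp s (hbd s hs)
    exact (hw' s).div (by fun_prop) (hden s hs)
  have hu0 : u 0 = 1 := by
    have := hden 0 (by rw [hn0]; positivity)
    rw [hb0] at this
    simp only [hu, hb0, hw, ofReal_zero, zero_mul, add_zero]
    exact div_self this
  have hslit : ∀ᶠ s in 𝓝 (0 : ℝ), u s ∈ slitPlane :=
    (hud 0 (by rw [hn0]; positivity)).continuousAt.eventually_mem
      (isOpen_slitPlane.mem_nhds (by rw [hu0]; exact one_mem_slitPlane))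
  have hφd : ∀ s, 0 < normSq (w s) - α ^ 2 → u s ∈ slitPlane → DifferentiableAt ℝ φ s :=
    fun s hs hs' => by
      have : DifferentiableAt ℝ (fun s => (log (u s)).im) s :=
        imCLM.differentiableAt.comp s ((hud s hs).hasDerivAt.clog_real hs').differentiableAt
      exact this.const_add _
  have heq : ∀ s, 0 < normSq (w s) - α ^ 2 → u s ∈ slitPlane →
      ((b s : ℝ) + I * α) * exp (φ s * I) = w s := fun s hs hs' => by
    have hunorm : ‖u s‖ = 1 := by
      have h₁ : normSq ((b s : ℂ) + I * α) = normSq (w s) := by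
        have : b s * b s = normSq (w s) - α ^ 2 := Real.mul_self_sqrt hs.le
        simp [normSq_apply] at this ⊢
        linarith
      have h₂ : ‖(b s : ℂ) + I * α‖ = ‖w s‖ := by
        rw [← sq_eq_sq₀ (norm_nonneg _) (norm_nonneg _), ← normSq_eq_norm_sq, h₁,
          normSq_eq_norm_sq]
      have h₃ := norm_ne_zero_iff.2 (hden s hs)
      rw [norm_mul, norm_exp_ofReal_mul_I, mul_one, h₂] at h₃
      simp only [hu, norm_div, norm_mul, norm_exp_ofReal_mul_I, mul_one, h₂]
      exact div_self h₃
    have hexp : exp ((log (u s)).im * I) = u s := by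
      conv_rhs => rw [← exp_log (slitPlane_ne_zero hs')]
      congr 1
      apply Complex.ext <;> simp [log_re, hunorm]
    have : exp (φ s * I) = exp (φ₀ * I) * u s := by
      rw [← hexp, ← exp_add]
      simp only [hφ]
      push_cast
      ring_nf
    rw [this, ← mul_assoc]
    simp only [hu]
    exact mul_div_cancel₀ _ (hden s hs)
  have hφ0 : φ 0 = φ₀ := by simp [hφ, hu0]
  refine ⟨b, φ, hb0, hφ0, ?_, ?_⟩
  · filter_upwards [hpos, hslit] with s hs hs'
    exact ⟨(hbd s hs).continuousAt, (hφd s hs hs').continuousAt, heq s hs hs'⟩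
  · have hB := (hbd 0 hpos.self_of_nhds).hasDerivAt
    have hΦ := (hφd 0 hpos.self_of_nhds hslit.self_of_nhds).hasDerivAt
    -- Differentiating `(b + iα)e^{iφ} = w` and dividing by `e^{iφ₀}` gives `b' + (b₀ + iα)iφ'`,
    -- whose real part is `b' - αφ'`.
    have h₁ := (hB.ofReal_comp.add_const (I * α)).mul (hΦ.ofReal_comp.mul_const I).cexp
    have h₂ : HasDerivAt w v 0 := by
      have := ((hasDerivAt_id (0 : ℝ)).ofReal_comp.mul_const v).const_add
        ((b₀ + I * α) * exp (φ₀ * I))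
      simpa [hw] using this
    have h₃ := h₁.unique (h₂.congr_of_eventuallyEq (by
      filter_upwards [hpos, hslit] with s hs hs'
      exact heq s hs hs'))
    have h₄ : v * exp (-(φ₀ * I)) =
        deriv b 0 + (b₀ + I * α) * (deriv φ 0 * I) := by
      rw [← h₃, hb0, hφ0, exp_neg]
      have := exp_ne_zero (φ₀ * I)
      field_simp
    have h₅ : (v * exp (-(φ₀ * I))).re = deriv b 0 - α * deriv φ 0 := by
      rw [h₄]; simp [sub_eq_add_neg]
    rw [h₅]
    exact hB.sub (hΦ.const_mul α)

/-! ### Turning numbers and homotopies read off from angles -/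

theorem velocity_ofAngle {θ : ℝ → ℝ} {L : ℝ} (hL : 0 < L) (hθ : Continuous θ)
    (hB : IsPiecewiseAffine θ) (hx : exp (θ 0 * I) = x.2) (hy : exp (θ L * I) = y.2)
    (hxy : angleCurve x.1 θ L = y.1) {t : ℝ} (ht : t ∈ Icc 0 L) :
    (ofAngle θ L hL hθ hB hx hy hxy).velocity t = exp (θ t * I) :=
  derivWithin_angleCurve x.1 hθ hL ht

theorem hasTurningNumber_of_velocity_eq (γ : BCPath x y) {θ : ℝ → ℝ} (hθ : Continuous θ)
    (h : ∀ t ∈ Icc 0 γ.length, γ.velocity t = exp (θ t * I)) {n : ℤ}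
    (hn : θ γ.length - θ 0 = arg (y.2 / x.2) + 2 * Real.pi * n) : γ.HasTurningNumber n :=
  ⟨θ, ⟨hθ.continuousOn, h⟩, hn⟩

theorem exp_angle_zero (γ : BCPath x y) {θ : ℝ → ℝ}
    (h : ∀ t ∈ Icc 0 γ.length, γ.velocity t = exp (θ t * I)) : exp (θ 0 * I) = x.2 :=
  (h 0 ⟨le_rfl, γ.length_pos.le⟩).symm.trans γ.start_dir

theorem exp_angle_length (γ : BCPath x y) {θ : ℝ → ℝ}
    (h : ∀ t ∈ Icc 0 γ.length, γ.velocity t = exp (θ t * I)) : exp (θ γ.length * I) = y.2 :=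
  (h _ ⟨γ.length_pos.le, le_rfl⟩).symm.trans γ.end_dir

theorem exists_turning_eq (γ : BCPath x y) {θ : ℝ → ℝ}
    (h : ∀ t ∈ Icc 0 γ.length, γ.velocity t = exp (θ t * I)) :
    ∃ n : ℤ, θ γ.length - θ 0 = arg (y.2 / x.2) + 2 * Real.pi * n := by
  have hd : y.2 / x.2 = exp ((θ γ.length - θ 0 : ℝ) * I) := by
    rw [← γ.exp_angle_zero h, ← γ.exp_angle_length h, ← exp_sub]
    push_cast
    ring_nf
  have hn : ‖y.2 / x.2‖ = 1 := by rw [hd, norm_exp_ofReal_mul_I]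
  have := norm_mul_exp_arg_mul_I (y.2 / x.2)
  rw [hn, ofReal_one, one_mul] at this
  obtain ⟨n, hn⟩ := exp_eq_exp_iff_exists_int.1 (hd.symm.trans this.symm)
  refine ⟨n, ?_⟩
  have := congrArg im hn
  simp at this
  linarith

/-- A continuous family of angles that starts at the angle of `γ` and consistently yields paths
from `x` to `y` is a bounded curvature homotopy. -/
theorem exists_boundedHomotopic (γ : BCPath x y) (Θ : unitInterval → ℝ → ℝ)
    (ℓ : unitInterval → ℝ) (hΘ : Continuous (Function.uncurry Θ)) (hℓ : Continuous ℓ)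
    (hpos : ∀ p, 0 < ℓ p) (hB : ∀ p, IsPiecewiseAffine (Θ p)) (hx : ∀ p, exp (Θ p 0 * I) = x.2)
    (hy : ∀ p, exp (Θ p (ℓ p) * I) = y.2) (hxy : ∀ p, angleCurve x.1 (Θ p) (ℓ p) = y.1)
    (hℓ₀ : ℓ 0 = γ.length) (h₀ : ∀ t ∈ Icc 0 γ.length, γ.velocity t = exp (Θ 0 t * I)) :
    ∃ η : BCPath x y, γ.BoundedHomotopic η ∧ η.length = ℓ 1 ∧
      ∀ t ∈ Icc 0 η.length, η.velocity t = exp (Θ 1 t * I) := by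
  have hc : ∀ p, Continuous (Θ p) := fun p => hΘ.comp (by fun_prop : Continuous fun t => (p, t))
  set H : unitInterval → BCPath x y := fun p =>
    ofAngle (Θ p) (ℓ p) (hpos p) (hc p) (hB p) (hx p) (hy p) (hxy p) with hH
  have hmem : ∀ q : unitInterval × unitInterval, (q.2 : ℝ) * ℓ q.1 ∈ Icc 0 (ℓ q.1) := fun q =>
    ⟨mul_nonneg q.2.2.1 (hpos _).le, mul_le_of_le_one_left (hpos _).le q.2.2.2⟩
  refine ⟨H 1, ⟨H, ⟨hℓ₀, (γ.eqOn_angleCurve (hc 0) h₀).symm⟩, ⟨rfl, fun _ _ => rfl⟩, hℓ, ?_, ?_⟩,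
    rfl, fun t ht => velocity_ofAngle _ _ _ _ _ _ ht⟩
  · change Continuous fun q : unitInterval × unitInterval =>
      x.1 + ∫ u in (0 : ℝ)..((q.2 : ℝ) * ℓ q.1), exp (Θ q.1 u * I)
    refine continuous_const.add
      (intervalIntegral.continuous_parametric_intervalIntegral_of_continuous
        (f := fun (q : unitInterval × unitInterval) u => exp (Θ q.1 u * I)) ?_ (by fun_prop))
    have : Continuous fun r : (unitInterval × unitInterval) × ℝ => Θ r.1.1 r.2 :=
      hΘ.comp (by fun_prop : Continuous fun r : (unitInterval × unitInterval) × ℝ => (r.1.1, r.2))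
    change Continuous fun r : (unitInterval × unitInterval) × ℝ => exp (Θ r.1.1 r.2 * I)
    fun_prop
  · have : Continuous fun q : unitInterval × unitInterval => Θ q.1 ((q.2 : ℝ) * ℓ q.1) :=
      hΘ.comp (by fun_prop :
        Continuous fun q : unitInterval × unitInterval => (q.1, (q.2 : ℝ) * ℓ q.1))
    refine (by fun_prop : Continuous fun q : unitInterval × unitInterval =>
      exp (Θ q.1 ((q.2 : ℝ) * ℓ q.1) * I)).congr fun q => ?_
    exact (velocity_ofAngle _ _ _ _ _ _ (hmem q)).symm

theorem IsCSCSC.exists_angle {γ : BCPath x y} {t₁ t₂ t₃ t₄ : ℝ} (h : γ.IsCSCSC t₁ t₂ t₃ t₄)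
    (ht : ¬ γ.HasTrivialPiece t₁ t₂ t₃ t₄) :
    (0 < t₁ ∧ t₁ < t₂ ∧ t₂ < t₃ ∧ t₃ < t₄ ∧ t₄ < γ.length) ∧
    ∃ θ₀ ε₁ ε₂ ε₃ : ℝ, (ε₁ = 1 ∨ ε₁ = -1) ∧ (ε₂ = 1 ∨ ε₂ = -1) ∧ (ε₃ = 1 ∨ ε₃ = -1) ∧
      ∀ t ∈ Icc 0 γ.length,
        γ.velocity t = exp (cscscAngle θ₀ ε₁ ε₂ ε₃ t₁ t₂ t₃ t₄ t * I) := by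
  obtain ⟨⟨h₁, h₂, h₃, h₄, h₅⟩, a₁, s₁, a₂, s₂, a₃⟩ := h
  simp only [HasTrivialPiece, not_or] at ht
  obtain ⟨n₁, n₂, n₃, n₄, n₅⟩ := ht
  replace h₁ := lt_of_le_of_ne h₁ (Ne.symm n₁)
  replace h₂ := lt_of_le_of_ne h₂ (Ne.symm n₂)
  replace h₃ := lt_of_le_of_ne h₃ (Ne.symm n₃)
  replace h₄ := lt_of_le_of_ne h₄ (Ne.symm n₄)
  replace h₅ := lt_of_le_of_ne h₅ (Ne.symm n₅)
  refine ⟨⟨h₁, h₂, h₃, h₄, h₅⟩, ?_⟩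
  obtain ⟨ε₁, hε₁, v₁⟩ := a₁.velocity_eq le_rfl h₁ (by linarith)
  have v₂ := s₁.velocity_eq (by linarith) h₂ (by linarith)
  obtain ⟨ε₂, hε₂, v₃⟩ := a₂.velocity_eq (by linarith) h₃ (by linarith)
  have v₄ := s₂.velocity_eq (by linarith) h₄ (by linarith)
  obtain ⟨ε₃, hε₃, v₅⟩ := a₃.velocity_eq (by linarith) h₅ le_rfl
  have hv₀ : γ.velocity 0 = exp (arg (γ.velocity 0) * I) := by
    have := norm_mul_exp_arg_mul_I (γ.velocity 0)
    rw [velocity, γ.unit_speed 0 ⟨le_rfl, γ.length_pos.le⟩, ofReal_one, one_mul] at this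
    exact this.symm
  set θ₀ := arg (γ.velocity 0)
  have w₁ : ∀ t ∈ Icc 0 t₁, γ.velocity t = exp ((θ₀ + ε₁ * t : ℝ) * I) := fun t ht => by
    rw [v₁ t ht, hv₀, ← exp_add]
    push_cast
    ring_nf
  have w₂ : ∀ t ∈ Icc t₁ t₂, γ.velocity t = exp ((θ₀ + ε₁ * t₁ : ℝ) * I) := fun t ht => by
    rw [v₂ t ht, w₁ t₁ ⟨h₁.le, le_rfl⟩]
  have w₃ : ∀ t ∈ Icc t₂ t₃,
      γ.velocity t = exp ((θ₀ + ε₁ * t₁ + ε₂ * (t - t₂) : ℝ) * I) := fun t ht => by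
    rw [v₃ t ht, w₂ t₂ ⟨h₂.le, le_rfl⟩, ← exp_add]
    push_cast
    ring_nf
  have w₄ : ∀ t ∈ Icc t₃ t₄,
      γ.velocity t = exp ((θ₀ + ε₁ * t₁ + ε₂ * (t₃ - t₂) : ℝ) * I) := fun t ht => by
    rw [v₄ t ht, w₃ t₃ ⟨h₃.le, le_rfl⟩]
  refine ⟨θ₀, ε₁, ε₂, ε₃, hε₁, hε₂, hε₃, fun t ht => ?_⟩
  rcases le_total t t₁ with q₁ | q₁
  · rw [cscscAngle_first h₂.le h₃.le h₄.le q₁, w₁ t ⟨ht.1, q₁⟩]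
  rcases le_total t t₂ with q₂ | q₂
  · rw [cscscAngle_second h₃.le h₄.le ⟨q₁, q₂⟩, w₂ t ⟨q₁, q₂⟩]
  rcases le_total t t₃ with q₃ | q₃
  · rw [cscscAngle_third h₂.le h₄.le ⟨q₂, q₃⟩, w₃ t ⟨q₂, q₃⟩]
  rcases le_total t t₄ with q₄ | q₄
  · rw [cscscAngle_fourth h₂.le h₃.le ⟨q₃, q₄⟩, w₄ t ⟨q₃, q₄⟩]
  · rw [cscscAngle_fifth h₂.le h₃.le h₄.le q₄, v₅ t ⟨q₄, ht.2⟩, w₄ t₄ ⟨h₄.le, le_rfl⟩, ← exp_add]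
    push_cast
    ring_nf

/-! ### Shortening a `cscsc` path -/

theorem abs_le_one_of_sign {ε : ℝ} (h : ε = 1 ∨ ε = -1) : |ε| ≤ 1 := by
  rcases h with rfl | rfl <;> simp

theorem sign_mul_cancel {ε : ℝ} (h : ε = 1 ∨ ε = -1) (a : ℝ) : ε * (ε * a) = a := by
  rcases h with rfl | rfl <;> ring

theorem eventually_lt_of_hasDerivAt_neg {f : ℝ → ℝ} {f' a : ℝ} (hf : HasDerivAt f f' a)
    (h : f' < 0) : ∀ᶠ s in 𝓝[>] a, f s < f a := by
  have := (hasDerivWithinAt_iff_tendsto_slope' self_notMem_Ioi).1 (hf.hasDerivWithinAt (s := Ioi a))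
  filter_upwards [this.eventually_lt_const h, self_mem_nhdsWithin] with s hs has
  rw [slope_def_field, div_lt_iff₀ (sub_pos.2 has)] at hs
  linarith

/-- First variation: translating the middle circle along the difference of the two segment
directions decreases the length to first order. Positivity of all five pieces is an open condition,
so small translations keep the type and the orientations. -/
theorem exists_shorter_of_cscscAngle (γ : BCPath x y) {θ₀ ε₁ ε₂ ε₃ t₁ t₂ t₃ t₄ : ℝ}
    (h₁ : 0 < t₁) (h₁₂ : t₁ < t₂) (h₂₃ : t₂ < t₃) (h₃₄ : t₃ < t₄) (h₄₅ : t₄ < γ.length)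
    (hε₁ : ε₁ = 1 ∨ ε₁ = -1) (hε₂ : ε₂ = 1 ∨ ε₂ = -1) (hε₃ : ε₃ = 1 ∨ ε₃ = -1)
    (hv : ∀ t ∈ Icc 0 γ.length,
      γ.velocity t = exp (cscscAngle θ₀ ε₁ ε₂ ε₃ t₁ t₂ t₃ t₄ t * I))
    (hne : exp ((θ₀ + ε₁ * t₁ : ℝ) * I) ≠ exp ((θ₀ + ε₁ * t₁ + ε₂ * (t₃ - t₂) : ℝ) * I)) :
    ∃ η : BCPath x y, γ.BoundedHomotopic η ∧ η.length < γ.length ∧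
      ∃ θ : ℝ → ℝ, Continuous θ ∧ (∀ t ∈ Icc 0 η.length, η.velocity t = exp (θ t * I)) ∧
        θ η.length - θ 0 = cscscAngle θ₀ ε₁ ε₂ ε₃ t₁ t₂ t₃ t₄ γ.length -
          cscscAngle θ₀ ε₁ ε₂ ε₃ t₁ t₂ t₃ t₄ 0 := by
  set φ₁ := θ₀ + ε₁ * t₁ with hφ₁
  set φ₂ := φ₁ + ε₂ * (t₃ - t₂) with hφ₂
  set φ₃ := φ₂ + ε₃ * (γ.length - t₄) with hφ₃
  set v : ℂ := exp (φ₂ * I) - exp (φ₁ * I) with hvdef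
  have hx := γ.exp_angle_zero hv
  have hy := γ.exp_angle_length hv
  have hend := γ.eqOn_angleCurve continuous_cscscAngle hv ⟨γ.length_pos.le, le_rfl⟩
  rw [γ.end_point, angleCurve,
    integral_exp_cscscAngle hε₁ hε₂ hε₃ h₁.le h₁₂.le h₂₃.le h₃₄.le h₄₅.le] at hend
  rw [cscscAngle_first h₁₂.le h₂₃.le h₃₄.le h₁.le, mul_zero, add_zero] at hx
  rw [cscscAngle_fifth h₁₂.le h₂₃.le h₃₄.le h₄₅.le] at hy
  rw [cscscAngle_fifth h₁₂.le h₂₃.le h₃₄.le h₄₅.le, cscscAngle_first h₁₂.le h₂₃.le h₃₄.le h₁.le,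
    mul_zero, add_zero]
  simp only [← hφ₁, ← hφ₂, ← hφ₃] at hend hy ⊢
  obtain ⟨b, φ, hb₀, hφ₀, hbφ, hbφ'⟩ :=
    exists_tangent_family (ε₂ - ε₁) (t₂ - t₁) φ₁ (sub_pos.2 h₁₂) v
  obtain ⟨c, ψ, hc₀, hψ₀, hcψ, hcψ'⟩ :=
    exists_tangent_family (ε₃ - ε₂) (t₄ - t₃) φ₂ (sub_pos.2 h₃₄) (-v)
  -- Break points are recovered from the segment lengths and angles: an arc of orientation `ε`
  -- turning by `δ` has length `εδ`. The end angles `θ₀` and `φ₃` stay fixed.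
  set T₁ : ℝ → ℝ := fun s => ε₁ * (φ s - θ₀) with hT₁
  set T₂ : ℝ → ℝ := fun s => T₁ s + b s with hT₂
  set T₃ : ℝ → ℝ := fun s => T₂ s + ε₂ * (ψ s - φ s) with hT₃
  set T₄ : ℝ → ℝ := fun s => T₃ s + c s with hT₄
  set T₅ : ℝ → ℝ := fun s => T₄ s + ε₃ * (φ₃ - ψ s) with hT₅
  have hT₁0 : T₁ 0 = t₁ := by
    simp only [hT₁, hφ₀, hφ₁, add_sub_cancel_left, sign_mul_cancel hε₁]
  have hT₂0 : T₂ 0 = t₂ := by simp only [hT₂, hT₁0, hb₀]; ring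
  have hT₃0 : T₃ 0 = t₃ := by
    simp only [hT₃, hT₂0, hφ₀, hψ₀, hφ₂, add_sub_cancel_left, sign_mul_cancel hε₂]; ring
  have hT₄0 : T₄ 0 = t₄ := by simp only [hT₄, hT₃0, hc₀]; ring
  have hT₅0 : T₅ 0 = γ.length := by
    simp only [hT₅, hT₄0, hψ₀, hφ₃, add_sub_cancel_left, sign_mul_cancel hε₃]; ring
  have hderiv : HasDerivAt T₅ (-(normSq v)) 0 := by
    have := (hbφ'.add hcψ').add_const (ε₃ * φ₃ - ε₁ * θ₀)
    -- The left side is the inner product of `v` with `e^{iφ₁} - e^{iφ₂} = -v`.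
    have hd : (v * exp (-(φ₁ * I))).re + (-v * exp (-(φ₂ * I))).re = -(normSq v) := by
      have he : ∀ r : ℝ, exp (-(r * I)) = (starRingEnd ℂ) (exp (r * I)) := fun r => by
        rw [← exp_conj, map_mul, conj_ofReal, conj_I, mul_neg]
      rw [he, he, ← add_re, ← ofReal_re (-(normSq v)), ofReal_neg, ← mul_conj]
      congr 1
      simp only [hvdef, map_sub]
      ring
    have hfun : T₅ = fun s => (b s - (ε₂ - ε₁) * φ s + (c s - (ε₃ - ε₂) * ψ s)) +
        (ε₃ * φ₃ - ε₁ * θ₀) := by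
      ext s
      simp only [hT₅, hT₄, hT₃, hT₂, hT₁]
      ring
    rw [← hd, hfun]
    exact this
  have hneg : -(normSq v) < 0 :=
    neg_lt_zero.2 (normSq_pos.2 (sub_ne_zero.2 hne.symm))
  have hgood : ∀ᶠ s in 𝓝 0, (ContinuousAt b s ∧ ContinuousAt φ s ∧
      ((b s : ℝ) + I * (ε₂ - ε₁ : ℝ)) * exp (φ s * I) =
        ((t₂ - t₁ : ℝ) + I * (ε₂ - ε₁ : ℝ)) * exp (φ₁ * I) + s * v) ∧
      (ContinuousAt c s ∧ ContinuousAt ψ s ∧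
      ((c s : ℝ) + I * (ε₃ - ε₂ : ℝ)) * exp (ψ s * I) =
        ((t₄ - t₃ : ℝ) + I * (ε₃ - ε₂ : ℝ)) * exp (φ₂ * I) + s * -v) ∧
      0 < T₁ s ∧ T₁ s < T₂ s ∧ T₂ s < T₃ s ∧ T₃ s < T₄ s ∧ T₄ s < T₅ s := by
    obtain ⟨hb, hφ, -⟩ := hbφ.self_of_nhds
    obtain ⟨hc, hψ, -⟩ := hcψ.self_of_nhds
    have c₁ : ContinuousAt T₁ 0 := by fun_prop
    have c₂ : ContinuousAt T₂ 0 := by fun_prop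
    have c₃ : ContinuousAt T₃ 0 := by fun_prop
    have c₄ : ContinuousAt T₄ 0 := by fun_prop
    have c₅ : ContinuousAt T₅ 0 := by fun_prop
    filter_upwards [hbφ, hcψ, c₁.eventually_const_lt (hT₁0 ▸ h₁),
      c₁.eventually_lt c₂ (by rwa [hT₁0, hT₂0]), c₂.eventually_lt c₃ (by rwa [hT₂0, hT₃0]),
      c₃.eventually_lt c₄ (by rwa [hT₃0, hT₄0]), c₄.eventually_lt c₅ (by rwa [hT₄0, hT₅0])]
      with s p₁ p₂ p₃ p₄ p₅ p₆ p₇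
    exact ⟨p₁, p₂, p₃, p₄, p₅, p₆, p₇⟩
  obtain ⟨δ, hδ, hgood⟩ := Metric.eventually_nhds_iff.1 hgood
  -- The homotopy runs over `s = pσ`. Only its final member has to be shorter; the choice `σ < δ`
  -- keeps every intermediate member valid.
  obtain ⟨σ, hσ, hσ₀, hσδ⟩ :=
    ((eventually_lt_of_hasDerivAt_neg hderiv hneg).and (Ioo_mem_nhdsGT hδ)).exists
  replace hgood := fun p : unitInterval => hgood (y := p * σ) (by
    rw [Real.dist_0_eq_abs, abs_of_nonneg (mul_nonneg p.2.1 hσ₀.le)]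
    exact (mul_le_of_le_one_left hσ₀.le p.2.2).trans_lt hσδ)
  have hcont : ∀ f : ℝ → ℝ, (∀ p : unitInterval, ContinuousAt f (p * σ)) →
      Continuous fun p : unitInterval => f (p * σ) := fun f hf =>
    continuous_iff_continuousAt.2 fun p =>
      (hf p).comp (f := fun p : unitInterval => (p : ℝ) * σ) (by fun_prop)
  have cb := hcont b fun p => (hgood p).1.1
  have cφ := hcont φ fun p => (hgood p).1.2.1
  have cc := hcont c fun p => (hgood p).2.1.1
  have cψ := hcont ψ fun p => (hgood p).2.1.2.1
  have c₁ : Continuous fun p : unitInterval => T₁ (p * σ) :=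
    continuous_const.mul (cφ.sub continuous_const)
  have c₂ : Continuous fun p : unitInterval => T₂ (p * σ) := c₁.add cb
  have c₃ : Continuous fun p : unitInterval => T₃ (p * σ) :=
    c₂.add (continuous_const.mul (cψ.sub cφ))
  have c₄ : Continuous fun p : unitInterval => T₄ (p * σ) := c₃.add cc
  have c₅ : Continuous fun p : unitInterval => T₅ (p * σ) :=
    c₄.add (continuous_const.mul (continuous_const.sub cψ))
  have eφ : ∀ s, θ₀ + ε₁ * T₁ s = φ s := fun s => by
    simp only [hT₁, sign_mul_cancel hε₁]; ring
  have eψ : ∀ s, φ s + ε₂ * (T₃ s - T₂ s) = ψ s := fun s => by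
    simp only [hT₃, add_sub_cancel_left, sign_mul_cancel hε₂]; ring
  have eφ₃ : ∀ s, ψ s + ε₃ * (T₅ s - T₄ s) = φ₃ := fun s => by
    simp only [hT₅, add_sub_cancel_left, sign_mul_cancel hε₃]; ring
  have hstart : ∀ p : unitInterval, cscscAngle θ₀ ε₁ ε₂ ε₃ (T₁ (p * σ)) (T₂ (p * σ)) (T₃ (p * σ))
      (T₄ (p * σ)) 0 = θ₀ := fun p => by
    obtain ⟨-, -, q₁, q₂, q₃, q₄, q₅⟩ := hgood p
    rw [cscscAngle_first q₂.le q₃.le q₄.le q₁.le, mul_zero, add_zero]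
  have hfinal : ∀ p : unitInterval, cscscAngle θ₀ ε₁ ε₂ ε₃ (T₁ (p * σ)) (T₂ (p * σ)) (T₃ (p * σ))
      (T₄ (p * σ)) (T₅ (p * σ)) = φ₃ := fun p => by
    obtain ⟨-, -, q₁, q₂, q₃, q₄, q₅⟩ := hgood p
    rw [cscscAngle_fifth q₂.le q₃.le q₄.le q₅.le, eφ, eψ, eφ₃]
  obtain ⟨η, hη, hηl, hηv⟩ := γ.exists_boundedHomotopic
    (fun p => cscscAngle θ₀ ε₁ ε₂ ε₃ (T₁ (p * σ)) (T₂ (p * σ)) (T₃ (p * σ)) (T₄ (p * σ)))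
    (fun p => T₅ (p * σ))
    (continuous_cscscAngle_comp (c₁.comp continuous_fst) (c₂.comp continuous_fst)
      (c₃.comp continuous_fst) (c₄.comp continuous_fst) continuous_snd)
    c₅
    (fun p => by
      obtain ⟨-, -, q₁, q₂, q₃, q₄, q₅⟩ := hgood p
      linarith)
    (fun p => by
      obtain ⟨-, -, q₁, q₂, q₃, q₄, q₅⟩ := hgood p
      exact isPiecewiseAffine_cscscAngle (abs_le_one_of_sign hε₁) (abs_le_one_of_sign hε₂)
        (abs_le_one_of_sign hε₃) q₂.le q₃.le q₄.le)
    (fun p => by rw [hstart, hx])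
    (fun p => by rw [hfinal, hy])
    (fun p => by
      -- The changes `sv` and `-sv` of the two vectors between centres cancel, so the end point does
      -- not move.
      obtain ⟨⟨-, -, hw⟩, ⟨-, -, hw'⟩, q₁, q₂, q₃, q₄, q₅⟩ := hgood p
      rw [hend, angleCurve,
        integral_exp_cscscAngle hε₁ hε₂ hε₃ q₁.le q₂.le q₃.le q₄.le q₅.le, eφ, eψ, eφ₃,
        show T₂ (p * σ) - T₁ (p * σ) = b (p * σ) from add_sub_cancel_left _ _,
        show T₄ (p * σ) - T₃ (p * σ) = c (p * σ) from add_sub_cancel_left _ _, hw, hw']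
      ring)
    (by simp only [Set.Icc.coe_zero, zero_mul, hT₅0])
    (by simpa only [Set.Icc.coe_zero, zero_mul, hT₁0, hT₂0, hT₃0, hT₄0] using hv)
  refine ⟨η, hη, ?_, _, continuous_cscscAngle, hηv, ?_⟩
  · rw [hηl, ← hT₅0]
    simpa using hσ
  · rw [hηl, hfinal, hstart]

/-- Full circles contribute no displacement and return to the same direction, so they can be
deleted. This changes the total turning, so the result is shorter in `Γ` but lies in another turning
class. -/
theorem exists_shorter_of_full_circles (γ : BCPath x y) {θ₀ ε₁ ε₂ ε₃ t₁ t₂ t₃ t₄ : ℝ}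
    (h₁ : 0 ≤ t₁) (h₁₂ : t₁ < t₂) (h₂₃ : t₂ < t₃) (h₃₄ : t₃ ≤ t₄) (h₄₅ : t₄ ≤ γ.length)
    (hε₁ : ε₁ = 1 ∨ ε₁ = -1) (hε₂ : ε₂ = 1 ∨ ε₂ = -1) (hε₃ : ε₃ = 1 ∨ ε₃ = -1)
    (hv : ∀ t ∈ Icc 0 γ.length,
      γ.velocity t = exp (cscscAngle θ₀ ε₁ ε₂ ε₃ t₁ t₂ t₃ t₄ t * I))
    {k : ℕ} (hk : t₃ - t₂ = 2 * Real.pi * k) :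
    ∃ η : BCPath x y, η.length < γ.length := by
  have hx := γ.exp_angle_zero hv
  have hy := γ.exp_angle_length hv
  have hend := γ.eqOn_angleCurve continuous_cscscAngle hv ⟨γ.length_pos.le, le_rfl⟩
  rw [γ.end_point, angleCurve,
    integral_exp_cscscAngle hε₁ hε₂ hε₃ h₁ h₁₂.le h₂₃.le h₃₄ h₄₅] at hend
  rw [cscscAngle_first h₁₂.le h₂₃.le h₃₄ h₁] at hx
  rw [cscscAngle_fifth h₁₂.le h₂₃.le h₃₄ h₄₅] at hy
  have hper : ∀ a b : ℝ, exp ((a + ε₂ * (t₃ - t₂) + b : ℝ) * I) = exp ((a + b : ℝ) * I) := by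
    intro a b
    rw [exp_eq_exp_iff_exists_int, hk]
    rcases hε₂ with rfl | rfl
    · refine ⟨k, ?_⟩
      push_cast
      ring
    · refine ⟨-k, ?_⟩
      push_cast
      ring
  have hper' : ∀ a : ℝ, exp ((a + ε₂ * (t₃ - t₂) : ℝ) * I) = exp (a * I) := fun a => by
    simpa using hper a 0
  rw [hper] at hy
  rw [hper, hper'] at hend
  have h₃₄' : t₂ ≤ t₄ - (t₃ - t₂) := by linarith
  have h₄₅' : t₄ - (t₃ - t₂) ≤ γ.length - (t₃ - t₂) := by linarith
  -- The repeated `t₂` makes the middle arc empty; later times move back by its former length.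
  refine ⟨ofAngle (cscscAngle θ₀ ε₁ ε₂ ε₃ t₁ t₂ t₂ (t₄ - (t₃ - t₂))) (γ.length - (t₃ - t₂))
    (by linarith) continuous_cscscAngle
    (isPiecewiseAffine_cscscAngle (abs_le_one_of_sign hε₁) (abs_le_one_of_sign hε₂)
      (abs_le_one_of_sign hε₃) h₁₂.le le_rfl h₃₄') ?_ ?_ ?_, ?_⟩
  · rw [cscscAngle_first h₁₂.le le_rfl h₃₄' h₁, hx]
  · rw [cscscAngle_fifth h₁₂.le le_rfl h₃₄' h₄₅', ← hy, sub_self, mul_zero, add_zero,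
      sub_sub_sub_cancel_right]
  · rw [hend, angleCurve, integral_exp_cscscAngle hε₁ hε₂ hε₃ h₁ h₁₂.le le_rfl h₃₄' h₄₅',
      sub_self, mul_zero, add_zero, sub_sub_sub_cancel_right,
      show t₄ - (t₃ - t₂) - t₂ = t₄ - t₃ by ring]
  · change γ.length - (t₃ - t₂) < γ.length
    linarith

theorem exp_ne_exp_of_forall_ne {ε a l : ℝ} (hε : ε = 1 ∨ ε = -1) (hl : 0 ≤ l)
    (h : ∀ k : ℕ, l ≠ 2 * Real.pi * k) : exp (a * I) ≠ exp ((a + ε * l : ℝ) * I) := by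
  intro he
  obtain ⟨n, hn⟩ := exp_eq_exp_iff_exists_int.1 he
  have hn' : ε * l = -(n * (2 * Real.pi)) := by
    have := congrArg im hn
    simp at this
    linarith
  -- The integer from periodicity has either sign, depending on `ε`, while `l ≥ 0`; absolute values
  -- reduce it to a natural number.
  apply h n.natAbs
  rw [Nat.cast_natAbs, Int.cast_abs, ← abs_of_nonneg hl, ← abs_of_pos Real.two_pi_pos, ← abs_mul]
  rcases hε with rfl | rfl
  · rw [← abs_neg, ← one_mul l, hn', neg_neg, mul_comm]
  · rw [← abs_neg, show -l = -1 * l by ring, hn', abs_neg, mul_comm]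

end BCPath

theorem proposition5p1 (x y : ℂ × ℂ) (γ : BCPath x y) (t₁ t₂ t₃ t₄ : ℝ)
    (hγ : γ.IsTypeC3 t₁ t₂ t₃ t₄) :
    (¬ γ.IsDegenerate t₁ t₂ t₃ t₄ →
      (∃ n : ℤ, γ ∈ BCPath.turningClass x y n ∧
        ¬ IsMinOn BCPath.length (BCPath.turningClass x y n) γ) ∧
      ¬ IsMinOn BCPath.length γ.homotopyClass γ) ∧
    (¬ γ.HasTrivialPiece t₁ t₂ t₃ t₄ →
      ¬ IsMinOn BCPath.length (univ : Set (BCPath x y)) γ) := by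
  have key : ∀ S : Set (BCPath x y), ∀ η ∈ S, η.length < γ.length →
      ¬ IsMinOn BCPath.length S γ := fun S η hη hlt h => (h hη).not_gt hlt
  have main : ¬ γ.IsDegenerate t₁ t₂ t₃ t₄ →
      (∃ n : ℤ, γ ∈ BCPath.turningClass x y n ∧
        ¬ IsMinOn BCPath.length (BCPath.turningClass x y n) γ) ∧
      ¬ IsMinOn BCPath.length γ.homotopyClass γ := by
    intro hdeg
    obtain ⟨htriv, hfull⟩ := not_or.1 hdeg
    obtain ⟨⟨h₁, h₁₂, h₂₃, h₃₄, h₄₅⟩, θ₀, ε₁, ε₂, ε₃, hε₁, hε₂, hε₃, hv⟩ :=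
      hγ.1.exists_angle htriv
    obtain ⟨η, hη, hlt, θ, hθ, hηv, hturn⟩ := γ.exists_shorter_of_cscscAngle h₁ h₁₂ h₂₃ h₃₄ h₄₅
      hε₁ hε₂ hε₃ hv
      (BCPath.exp_ne_exp_of_forall_ne hε₂ (sub_pos.2 h₂₃).le (not_exists.1 hfull))
    obtain ⟨n, hn⟩ := γ.exists_turning_eq hv
    exact ⟨⟨n, γ.hasTurningNumber_of_velocity_eq BCPath.continuous_cscscAngle hv hn,
      key _ η (η.hasTurningNumber_of_velocity_eq hθ hηv (hturn.trans hn)) hlt⟩, key _ η hη hlt⟩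
  refine ⟨main, fun htriv => ?_⟩
  -- With no trivial piece, degeneracy leaves only full circles to cut out; otherwise the shorter
  -- homotopic path already rules out minimality in `Γ`.
  by_cases hdeg : γ.IsDegenerate t₁ t₂ t₃ t₄
  · obtain ⟨k, hk⟩ := hdeg.resolve_left htriv
    obtain ⟨⟨h₁, h₁₂, h₂₃, h₃₄, h₄₅⟩, θ₀, ε₁, ε₂, ε₃, hε₁, hε₂, hε₃, hv⟩ :=
      hγ.1.exists_angle htriv
    obtain ⟨η, hlt⟩ := γ.exists_shorter_of_full_circles h₁.le h₁₂ h₂₃ h₃₄.le h₄₅.le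
      hε₁ hε₂ hε₃ hv hk
    exact key _ η (mem_univ _) hlt
  · exact fun h => (main hdeg).2 (h.on_subset (subset_univ _))
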